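/- Work in a nonstandard universe satisfying the transfer principle. An internal probability space $(\Omega,\mathcal F,\mu)$ consists of an internal set $\Omega$, an internal algebra $\mathcal F$ of internal subsets of $\Omega$, and an internal, nonnegative, finitely additive function $\mu:\mathcal F\to{}^*\mathbb R$ with $\mu(\Omega)=1$; it is hyperfinite if $\mathcal F$ is a hyperfinite set ($\Omega$ itself need not be hyperfinite). Its Loeb algebra $\overline{\mathcal F}$ is the collection of all (possibly external) sets $B\subset\Omega$ such that $$\sup\{\mathsf{st}(\mu(A)): A\in\mathcal F,\ A\subset B\}=\inf\{\mathsf{st}(\mu(C)): C\in\mathcal F,\ B\subset C\},$$ where $\mathsf{st}$ is the standard part map, and for $B\in\overline{\mathcal F}$ the Loeb measure $\overline{\mu}(B)$ is this common value. Two internal probability spaces $(\Omega,\mathcal F,\mu)$ and $(\Omega,\mathcal G,\nu)$ on the same $\Omega$ are Loeb equivalent if $\overline{\mathcal F}=\overline{\mathcal G}$ and $\overline{\mu}=\overline{\nu}$. **Theorem.** Let $(\Omega,\mathcal F,\mu)$ and $(\Omega,\mathcal G,\nu)$ be Loeb equivalent hyperfinite probability spaces. Let $\mathcal F_0$ and $\mathcal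 G_0$ be the sets of atoms (that is, $\subset$-minimal nonempty elements) of $\mathcal F$ and $\mathcal G$, and let $$\mathcal F_0'=\{F\in\mathcal F_0:\ F\text{ intersects at least two elements of }\mathcal G_0\}.$$ Then $\bigcup\mathcal F_0'\in\mathcal F$ and $\mu\left(\bigcup\mathcal F_0'\right)\approx 0$, i.e. $\mu\left(\bigcup\mathcal F_0'\right)$ is infinitesimal. -/

import Mathlib

/-!
Nonstandard analysis in the usual superstructure setting, organised by (simple) types.
Over a set `S` of individuals and the reals we have the full standard hierarchy of types, closed
under products and power sets.  A nonstandard universe consists of the internal entities of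
each type together with a map `*` from standard to internal entities satisfying the
transfer principle for all formulas built from `∈`, `=`, pairing, the connectives and quantifiers
ranging over the entities of a given type (these are the bounded formulas).
-/

universe u v

noncomputable section

namespace NSA

/-- The types of entities: individuals, reals, ordered pairs, sets of entities of a given type. -/
inductive EType : Type
  | ind : EType
  | real : EType
  | prod : EType → EType → EType
  | pow : EType → EType

open EType

/-- The standard entities of each type over a set `S` of individuals (all pairs, all subsets). -/
def Std (S : Type u) : EType → Type u
  | ind => S
  | real => ULift.{u} ℝ
  | prod σ τ => Std S σ × Std S τ
  | pow τ => Set (Std S τ)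

/-- A real number as a standard entity. -/
def Std.ofReal {S : Type u} (r : ℝ) : Std S real := (ULift.up r : ULift.{u} ℝ)

/-- The real number given by a standard entity of type `real`. -/
def Std.toReal {S : Type u} (x : Std S real) : ℝ := ULift.down (x : ULift.{u} ℝ)

/-- First component of a standard pair. -/
def Std.fst {S : Type u} {σ τ : EType} (p : Std S (prod σ τ)) : Std S σ :=
  Prod.fst (p : Std S σ × Std S τ)

/-- Second component of a standard pair. -/
def Std.snd {S : Type u} {σ τ : EType} (p : Std S (prod σ τ)) : Std S τ :=
  Prod.snd (p : Std S σ × Std S τ)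

/-- Membership of standard entities. -/
def Std.Mem {S : Type u} {τ : EType} (a : Std S τ) (A : Std S (pow τ)) : Prop :=
  @Membership.mem (Std S τ) (Set (Std S τ)) _ A a

/-- Variables of type `τ` in a context (a list of the types of the free variables). -/
inductive Var : List EType → EType → Type
  | zero {Γ : List EType} {τ : EType} : Var (τ :: Γ) τ
  | succ {Γ : List EType} {σ τ : EType} : Var Γ τ → Var (σ :: Γ) τ

/-- Terms: variables, constants naming arbitrary standard entities, ordered pairs. -/
inductive Term (S : Type u) (Γ : List EType) : EType → Type u
  | var {τ : EType} : Var Γ τ → Term S Γ τ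
  | const {τ : EType} : Std S τ → Term S Γ τ
  | pair {σ τ : EType} : Term S Γ σ → Term S Γ τ → Term S Γ (prod σ τ)

/-- Formulas with free variables in the context `Γ`; quantifiers bind the variable `Var.zero`. -/
inductive Formula (S : Type u) : List EType → Type u
  | eq {Γ : List EType} {τ : EType} : Term S Γ τ → Term S Γ τ → Formula S Γ
  | mem {Γ : List EType} {τ : EType} : Term S Γ τ → Term S Γ (pow τ) → Formula S Γ
  | neg {Γ : List EType} : Formula S Γ → Formula S Γ
  | and {Γ : List EType} : Formula S Γ → Formula S Γ → Formula S Γ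
  | or {Γ : List EType} : Formula S Γ → Formula S Γ → Formula S Γ
  | imp {Γ : List EType} : Formula S Γ → Formula S Γ → Formula S Γ
  | all {Γ : List EType} (τ : EType) : Formula S (τ :: Γ) → Formula S Γ
  | ex {Γ : List EType} (τ : EType) : Formula S (τ :: Γ) → Formula S Γ

/-- An interpretation of the language: entities of each type, membership, pairing, and a value
`star a` for the constant naming the standard entity `a`. -/
structure Interp (S : Type u) where
  El : EType → Type v
  mem : {τ : EType} → El τ → El (pow τ) → Prop
  pair : {σ τ : EType} → El σ → El τ → El (prod σ τ)
  star : {τ : EType} → Std S τ → El τ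

/-- The standard interpretation. -/
def standard (S : Type u) : Interp.{u, u} S where
  El := Std S
  mem := Std.Mem
  pair := fun {σ τ} a b => ((a, b) : Std S σ × Std S τ)
  star := fun a => a

namespace Interp

variable {S : Type u}

/-- Assignments of values to the variables of a context. -/
def Env (M : Interp.{u, v} S) : List EType → Type v
  | [] => PUnit
  | τ :: Γ => M.El τ × Env M Γ

/-- The value of a variable. -/
def varVal (M : Interp.{u, v} S) : {Γ : List EType} → {τ : EType} → Var Γ τ → M.Env Γ → M.El τ
  | _, _, Var.zero, e => e.1
  | _, _, Var.succ x, e => varVal M x e.2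

/-- The value of a term. -/
def termVal (M : Interp.{u, v} S) {Γ : List EType} (e : M.Env Γ) :
    {τ : EType} → Term S Γ τ → M.El τ
  | _, Term.var x => M.varVal x e
  | _, Term.const a => M.star a
  | _, Term.pair s t => M.pair (termVal M e s) (termVal M e t)

/-- Satisfaction of formulas. -/
def Sat (M : Interp.{u, v} S) : {Γ : List EType} → Formula S Γ → M.Env Γ → Prop
  | _, Formula.eq s t, e => M.termVal e s = M.termVal e t
  | _, Formula.mem s t, e => M.mem (M.termVal e s) (M.termVal e t)
  | _, Formula.neg φ, e => ¬ Sat M φ e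
  | _, Formula.and φ ψ, e => Sat M φ e ∧ Sat M ψ e
  | _, Formula.or φ ψ, e => Sat M φ e ∨ Sat M ψ e
  | _, Formula.imp φ ψ, e => Sat M φ e → Sat M ψ e
  | _, Formula.all τ φ, e => ∀ x : M.El τ, Sat M φ (x, e)
  | _, Formula.ex τ φ, e => ∃ x : M.El τ, Sat M φ (x, e)

/-- Truth of a sentence. -/
def Holds (M : Interp.{u, v} S) (φ : Formula S []) : Prop := M.Sat φ PUnit.unit

end Interp

/-- A nonstandard universe over `S`: an interpretation, with map `star` from the standard to the
internal entities, satisfying the transfer principle. (Extensionality of internal sets, the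
pairing laws, the ordered field laws of the hyperreals and so on are instances of transfer.) -/
structure NonstandardUniverse (S : Type u) extends Interp.{u, v} S where
  transfer : ∀ φ : Formula S [], (standard S).Holds φ ↔ toInterp.Holds φ

namespace NonstandardUniverse

variable {S : Type u} (N : NonstandardUniverse.{u, v} S)

/-- The hyperreal number `*r` of a real number `r`. -/
def real (r : ℝ) : N.El real := N.star (Std.ofReal r)

instance : Nonempty (N.El EType.real) := ⟨N.real 0⟩

/-- The external set of the elements of an internal set. -/
def ext {τ : EType} (A : N.El (pow τ)) : Set (N.El τ) := {x | N.mem x A}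

/-- The value at `a` of an internal hyperreal-valued function, given as an internal set of pairs
(an arbitrary value when `a` is not in the domain). -/
def app {σ : EType} (f : N.El (pow (prod σ EType.real))) (a : N.El σ) : N.El EType.real :=
  Classical.epsilon fun x => N.mem (N.pair a x) f

/-- Addition of hyperreals: the nonstandard extension of real addition. -/
def add (x y : N.El EType.real) : N.El EType.real :=
  N.app (N.star (τ := pow (prod (prod EType.real EType.real) EType.real))
    {p | p.fst.fst.toReal + p.fst.snd.toReal = p.snd.toReal}) (N.pair x y)

/-- Order of hyperreals: the nonstandard extension of the order of the reals. -/
def le (x y : N.El EType.real) : Prop :=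
  N.mem (N.pair x y) (N.star (τ := pow (prod EType.real EType.real))
    {p | p.fst.toReal ≤ p.snd.toReal})

/-- The standard part of a finite hyperreal. -/
def st (x : N.El EType.real) : ℝ := sSup {r : ℝ | N.le (N.real r) x}

/-- `x ≈ 0`. -/
def Infinitesimal (x : N.El EType.real) : Prop :=
  ∀ ε : ℝ, 0 < ε → N.le (N.real (-ε)) x ∧ N.le x (N.real ε)

/-- An internal set is hyperfinite if it belongs to the nonstandard extension of the collection
of all finite sets (of entities of the given type). -/
def Hyperfinite {τ : EType} (A : N.El (pow τ)) : Prop :=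
  N.mem A (N.star (τ := pow (pow τ)) {X : Set (Std S τ) | X.Finite})

end NonstandardUniverse

/-- An internal (finitely additive) probability space on an internal set `Ω`: an internal algebra
`alg` of internal subsets of `Ω` and an internal function `meas` from `alg` to the hyperreals. -/
structure InternalProbSpace {S : Type u} (N : NonstandardUniverse.{u, v} S) {τ : EType}
    (Ω : N.El (pow τ)) where
  alg : N.El (pow (pow τ))
  meas : N.El (pow (prod (pow τ) EType.real))
  subset_of_mem : ∀ A, N.mem A alg → N.ext A ⊆ N.ext Ω
  univ_mem : N.mem Ω alg
  compl_mem : ∀ A, N.mem A alg → ∃ C, N.mem C alg ∧ N.ext C = N.ext Ω \ N.ext A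
  union_mem : ∀ A B, N.mem A alg → N.mem B alg →
    ∃ C, N.mem C alg ∧ N.ext C = N.ext A ∪ N.ext B
  meas_dom : ∀ A x, N.mem (N.pair A x) meas → N.mem A alg
  meas_fun : ∀ A, N.mem A alg → ∃! x, N.mem (N.pair A x) meas
  meas_nonneg : ∀ A, N.mem A alg → N.le (N.real 0) (N.app meas A)
  meas_univ : N.app meas Ω = N.real 1
  meas_union : ∀ A B C, N.mem A alg → N.mem B alg → N.mem C alg →
    Disjoint (N.ext A) (N.ext B) → N.ext C = N.ext A ∪ N.ext B →
      N.app meas C = N.add (N.app meas A) (N.app meas B)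

namespace InternalProbSpace

variable {S : Type u} {N : NonstandardUniverse.{u, v} S} {τ : EType} {Ω : N.El (pow τ)}

/-- An internal probability space is hyperfinite if its algebra is (`Ω` need not be). -/
def IsHyperfinite (P : InternalProbSpace N Ω) : Prop := N.Hyperfinite P.alg

/-- `sup {st (μ A) : B ⊇ A ∈ F}`. -/
def inner (P : InternalProbSpace N Ω) (B : Set (N.El τ)) : ℝ :=
  sSup {r | ∃ A, N.mem A P.alg ∧ N.ext A ⊆ B ∧ r = N.st (N.app P.meas A)}

/-- `inf {st (μ C) : B ⊆ C ∈ F}`. -/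
def outer (P : InternalProbSpace N Ω) (B : Set (N.El τ)) : ℝ :=
  sInf {r | ∃ C, N.mem C P.alg ∧ B ⊆ N.ext C ∧ r = N.st (N.app P.meas C)}

/-- The Loeb algebra: the (external) subsets of `Ω` with equal inner and outer measure. -/
def loebAlgebra (P : InternalProbSpace N Ω) : Set (Set (N.El τ)) :=
  {B | B ⊆ N.ext Ω ∧ P.inner B = P.outer B}

/-- The Loeb measure (of a member of the Loeb algebra). -/
def loebMeasure (P : InternalProbSpace N Ω) (B : Set (N.El τ)) : ℝ := P.inner B

/-- Loeb equivalence: equal Loeb algebras and equal Loeb measures. -/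
def LoebEquivalent (P Q : InternalProbSpace N Ω) : Prop :=
  P.loebAlgebra = Q.loebAlgebra ∧ ∀ B ∈ P.loebAlgebra, P.loebMeasure B = Q.loebMeasure B

/-- The atoms of the algebra: its minimal nonempty members. -/
def IsAtom (P : InternalProbSpace N Ω) (A : N.El (pow τ)) : Prop :=
  N.mem A P.alg ∧ (N.ext A).Nonempty ∧
    ∀ E, N.mem E P.alg → (N.ext E).Nonempty → N.ext E ⊆ N.ext A → E = A

/-- The atoms of the algebra of `P` meeting at least two atoms of the algebra of `Q`. -/
def splitAtoms (P Q : InternalProbSpace N Ω) : Set (N.El (pow τ)) :=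
  {A | P.IsAtom A ∧ ∃ B B', Q.IsAtom B ∧ Q.IsAtom B' ∧ B ≠ B' ∧
    (N.ext A ∩ N.ext B).Nonempty ∧ (N.ext A ∩ N.ext B').Nonempty}

end InternalProbSpace

end NSA

end

/-!
Only one half of Loeb equivalence matters: every internal `V` in the second algebra is Loeb
measurable for the second space, hence for the first one, so it can be squeezed between members of
the first algebra of arbitrarily close measure.

Suppose that `U`, the union of the split atoms, has noninfinitesimal measure. For a finite algebra,
choose a random union `V` of atoms of the second algebra. A split atom `A` of the first algebra
meets two atoms of the second, and with probability `1/2` exactly one of these two is part of `V`.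
So some `V` splits atoms of total measure at least `m U / 2` (`exists_finset_splitting`). Every
inner approximation of `V` misses these atoms and every outer approximation contains them, so the
two differ in measure by at least `m U / 2` (`IsFinitelyAdditive.exists_defect`). This
finite statement transfers to hyperfinite algebras (`NonstandardUniverse.exists_defect`), and gives
an internal `V` of the second algebra whose inner and outer measures for the first differ by a
positive real: a contradiction.

For the transfer, standard predicates such as being a finite measure algebra or an atom enter
the language as constants naming the sets of tuples that satisfy them. They are
introduced and eliminated by transferring sentences whose satisfaction, in either universe, is
definitionally the intended statement.
-/

/-! ### Finite measure algebras -/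

namespace NSA

/-- Averaging: if every `i ∈ s` is related to at least two elements of `κ`, then some `t` splits a set
`s' ⊆ s` of at least half the total weight, since a uniformly random `t` splits each `i` with
probability at least `1/2`. -/
theorem exists_finset_splitting {ι κ : Type*} [Fintype κ] (s : Finset ι)
    (w : ι → ℝ) (hw : ∀ i ∈ s, 0 ≤ w i) (R : ι → κ → Prop)
    (hR : ∀ i ∈ s, ∃ b b', b ≠ b' ∧ R i b ∧ R i b') :
    ∃ t : Finset κ, ∃ s' ⊆ s, (∀ i ∈ s', (∃ b ∈ t, R i b) ∧ ∃ b, b ∉ t ∧ R i b) ∧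
      ∑ i ∈ s, w i ≤ 2 * ∑ i ∈ s', w i := by
  classical
  let P : Finset κ → ι → Prop := fun t i => (∃ b ∈ t, R i b) ∧ ∃ b, b ∉ t ∧ R i b
  let f : ι → Finset κ → ℝ := fun i t => if P t i then w i else 0
  have key : ∀ i ∈ s, ∑ _t : Finset κ, w i ≤ ∑ t : Finset κ, 2 * f i t := by
    intro i hi
    obtain ⟨b, b', hne, hb, hb'⟩ := hR i hi
    -- Toggling `b'` is an involution, and one of `t`, `t ∆ {b'}` separates `b` from `b'`.
    have hinv : Function.Involutive fun t : Finset κ => symmDiff t {b'} := fun t =>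
      symmDiff_symmDiff_cancel_right _ _
    have hsum : ∑ t : Finset κ, f i (symmDiff t {b'}) = ∑ t, f i t :=
      Equiv.sum_comp hinv.toPerm (f i)
    have hle : ∑ _t : Finset κ, w i ≤ ∑ t : Finset κ, (f i t + f i (symmDiff t {b'})) := by
      refine Finset.sum_le_sum fun t _ => ?_
      have h0 : ∀ t, 0 ≤ f i t := fun t => by
        simp only [f]; split_ifs <;> simp [hw i hi]
      have hsep : ∀ t : Finset κ, (b ∈ t ↔ b' ∉ t) → f i t = w i := by
        intro t ht
        have : P t i := by
          by_cases h : b ∈ t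
          · exact ⟨⟨b, h, hb⟩, b', ht.1 h, hb'⟩
          · exact ⟨⟨b', by tauto, hb'⟩, b, h, hb⟩
        simp [f, this]
      by_cases h : b ∈ t ↔ b' ∉ t
      · linarith [hsep t h, h0 (symmDiff t {b'})]
      · have : b ∈ symmDiff t {b'} ↔ b' ∉ symmDiff t {b'} := by
          simp only [Finset.mem_symmDiff, Finset.mem_singleton]
          tauto
        linarith [hsep _ this, h0 t]
    rw [Finset.sum_add_distrib, hsum] at hle
    rw [← Finset.mul_sum]
    linarith
  have htot : ∑ _t : Finset κ, ∑ i ∈ s, w i ≤ ∑ t : Finset κ, 2 * ∑ i ∈ s, f i t := by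
    simp only [Finset.mul_sum]
    rw [Finset.sum_comm, Finset.sum_comm (s := Finset.univ)]
    exact Finset.sum_le_sum key
  obtain ⟨t, -, ht⟩ := Finset.exists_le_of_sum_le Finset.univ_nonempty htot
  refine ⟨t, s.filter (P t), Finset.filter_subset _ _, fun i hi => (Finset.mem_filter.1 hi).2, ?_⟩
  rwa [Finset.sum_filter]

/-- `F` is an algebra of subsets of `Ω` and `m` is nonnegative and finitely additive on `F`. The
values of `m` off `F` are arbitrary; the total mass `m Ω` is not normalized. -/
structure IsFinitelyAdditive {T : Type*} (Ω : Set T) (F : Set (Set T)) (m : Set T → ℝ) : Prop where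
  subset_of_mem : ∀ A ∈ F, A ⊆ Ω
  univ_mem : Ω ∈ F
  diff_mem : ∀ A ∈ F, Ω \ A ∈ F
  union_mem : ∀ A ∈ F, ∀ B ∈ F, A ∪ B ∈ F
  nonneg : ∀ A ∈ F, 0 ≤ m A
  add : ∀ A ∈ F, ∀ B ∈ F, Disjoint A B → m (A ∪ B) = m A + m B

/-- `A` is a minimal nonempty member of `F`. Unbundled to match the formula that is transferred. -/
def IsAtomOf {T : Type*} (F : Set (Set T)) (A : Set T) : Prop :=
  A ∈ F ∧ (∃ x, x ∈ A) ∧ ∀ E, E ∈ F → (∃ x, x ∈ E) → (∀ x, x ∈ E → x ∈ A) → E = A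

/-- `A` is an atom of `F` that meets at least two atoms of `G`. -/
def IsSplitAtomOf {T : Type*} (F G : Set (Set T)) (A : Set T) : Prop :=
  IsAtomOf F A ∧ ∃ B B', IsAtomOf G B ∧ IsAtomOf G B' ∧ ¬ B = B' ∧
    (∃ x, x ∈ A ∧ x ∈ B) ∧ ∃ x, x ∈ A ∧ x ∈ B'

namespace IsFinitelyAdditive

variable {T : Type*} {Ω : Set T} {F G : Set (Set T)} {m n : Set T → ℝ}

theorem empty_mem (h : IsFinitelyAdditive Ω F m) : ∅ ∈ F := by
  simpa using h.diff_mem Ω h.univ_mem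

theorem inter_mem (h : IsFinitelyAdditive Ω F m) {A B : Set T} (hA : A ∈ F) (hB : B ∈ F) :
    A ∩ B ∈ F := by
  have := h.diff_mem _ (h.union_mem _ (h.diff_mem _ hA) _ (h.diff_mem _ hB))
  convert this using 1
  ext x
  have hΩ : x ∈ A → x ∈ Ω := fun hx => h.subset_of_mem A hA hx
  simp only [Set.mem_inter_iff, Set.mem_sdiff, Set.mem_union]
  tauto

theorem sdiff_mem (h : IsFinitelyAdditive Ω F m) {A B : Set T} (hA : A ∈ F) (hB : B ∈ F) :
    A \ B ∈ F := by
  convert h.inter_mem hA (h.diff_mem _ hB) using 1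
  ext x
  have hΩ : x ∈ A → x ∈ Ω := fun hx => h.subset_of_mem A hA hx
  simp only [Set.mem_inter_iff, Set.mem_sdiff]
  tauto

theorem mono (h : IsFinitelyAdditive Ω F m) {A B : Set T} (hA : A ∈ F) (hB : B ∈ F) (hAB : A ⊆ B) :
    m A ≤ m B := by
  have hd := h.sdiff_mem hB hA
  have := h.add A hA _ hd Set.disjoint_sdiff_right
  rw [Set.union_sdiff_cancel hAB] at this
  linarith [h.nonneg _ hd]

theorem empty_eq (h : IsFinitelyAdditive Ω F m) : m ∅ = 0 := by
  have := h.add ∅ h.empty_mem ∅ h.empty_mem (by simp)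
  simp at this
  exact this

theorem biUnion_mem (h : IsFinitelyAdditive Ω F m) (s : Finset (Set T)) (hs : ∀ A ∈ s, A ∈ F) :
    (⋃ A ∈ s, A) ∈ F := by
  classical
  induction s using Finset.induction_on with
  | empty => simpa using h.empty_mem
  | insert a s _ ih =>
    rw [Finset.set_biUnion_insert]
    exact h.union_mem _ (hs _ (by simp)) _ (ih fun A hA => hs A (by simp [hA]))

theorem biUnion_eq (h : IsFinitelyAdditive Ω F m) (s : Finset (Set T)) (hs : ∀ A ∈ s, A ∈ F)
    (hd : ∀ A ∈ s, ∀ B ∈ s, A ≠ B → Disjoint A B) :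
    m (⋃ A ∈ s, A) = ∑ A ∈ s, m A := by
  classical
  induction s using Finset.induction_on with
  | empty => simpa using h.empty_eq
  | insert a s ha ih =>
    rw [Finset.set_biUnion_insert, Finset.sum_insert ha, h.add, ih]
    · exact fun A hA => hs A (by simp [hA])
    · exact fun A hA B hB => hd A (by simp [hA]) B (by simp [hB])
    · exact hs _ (by simp)
    · exact h.biUnion_mem _ fun A hA => hs A (by simp [hA])
    · simp only [Set.disjoint_iUnion_right]
      exact fun A hA => hd _ (by simp) _ (by simp [hA]) fun e => ha (e ▸ hA)

theorem atom_subset (h : IsFinitelyAdditive Ω F m) {A B : Set T} (hA : IsAtomOf F A) (hB : B ∈ F)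
    (hAB : (A ∩ B).Nonempty) : A ⊆ B := by
  have := hA.2.2 _ (h.inter_mem hA.1 hB) hAB fun x hx => hx.1
  rw [← this]
  exact Set.inter_subset_right

theorem atom_eq (h : IsFinitelyAdditive Ω F m) {A B : Set T} (hA : IsAtomOf F A) (hB : IsAtomOf F B)
    (hAB : (A ∩ B).Nonempty) : A = B :=
  (h.atom_subset hA hB.1 hAB).antisymm (h.atom_subset hB hA.1 (Set.inter_comm A B ▸ hAB))

/-- The finite form of the theorem: some `V ∈ G` splits half the mass of the union `U` of the split
atoms, so that any `A, C ∈ F` with `A ⊆ V ⊆ C` differ in measure by at least half of `m U`.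
`V` is a union of atoms of `G`; an atom of `F` that meets both `V` and its complement misses `A`
and is contained in `C`. -/
theorem exists_defect (hF : IsFinitelyAdditive Ω F m) (hG : IsFinitelyAdditive Ω G n) (fF : F.Finite)
    (fG : G.Finite) :
    ∃ U V, U ∈ F ∧ (∀ x, x ∈ U ↔ ∃ A, IsSplitAtomOf F G A ∧ x ∈ A) ∧ V ∈ G ∧
      ∀ A ∈ F, ∀ C ∈ F, A ⊆ V → V ⊆ C → m A + m U / 2 ≤ m C := by
  classical
  have fs : {A | IsSplitAtomOf F G A}.Finite := fF.subset fun A hA => hA.1.1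
  have fg : {B | IsAtomOf G B}.Finite := fG.subset fun B hB => hB.1
  have : Fintype {B // IsAtomOf G B} := fg.fintype
  set s := fs.toFinset with hs
  have hsplit : ∀ A ∈ s, IsSplitAtomOf F G A := fun A hA => by simpa [hs] using hA
  obtain ⟨t, s', hs's, hs', hle⟩ := exists_finset_splitting (κ := {B // IsAtomOf G B}) s m
    (fun A hA => hF.nonneg _ (hsplit A hA).1.1) (fun A B => (A ∩ B.1).Nonempty) (by
      intro A hA
      obtain ⟨-, B, B', hB, hB', hne, hx, hx'⟩ := hsplit A hA
      exact ⟨⟨B, hB⟩, ⟨B', hB'⟩, fun e => hne (congrArg Subtype.val e), hx, hx'⟩)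
  have hdisj : ∀ A ∈ s, ∀ B ∈ s, A ≠ B → Disjoint A B := by
    intro A hA B hB hne
    by_contra hd
    exact hne (hF.atom_eq (hsplit A hA).1 (hsplit B hB).1 (Set.not_disjoint_iff_nonempty_inter.1 hd))
  have hmem : ∀ A ∈ s, A ∈ F := fun A hA => (hsplit A hA).1.1
  have hVt : ∀ x, x ∈ (⋃ B ∈ t.image Subtype.val, B) ↔ ∃ B ∈ t, x ∈ B.1 := by
    intro x; simp
  refine ⟨⋃ A ∈ s, A, ⋃ B ∈ t.image Subtype.val, B, hF.biUnion_mem s hmem, ?_,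
    hG.biUnion_mem _ ?_, ?_⟩
  · intro x; simp [hs]
  · intro B hB
    obtain ⟨B', -, rfl⟩ := Finset.mem_image.1 hB
    exact B'.2.1
  · intro A hA C hC hAV hVC
    -- `W` is the union of the atoms of `F` split by `V`; it lies in `C` and misses `A`.
    set W := ⋃ A ∈ s', A
    have hW : W ∈ F := hF.biUnion_mem s' fun A hA => hmem A (hs's hA)
    have hWeq : m W = ∑ A ∈ s', m A := hF.biUnion_eq s' (fun A hA => hmem A (hs's hA))
      fun A hA B hB => hdisj A (hs's hA) B (hs's hB)
    have hWC : W ⊆ C := by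
      refine Set.iUnion₂_subset fun E hE => ?_
      obtain ⟨⟨B, hB, x, hxE, hxB⟩, -⟩ := hs' E hE
      exact hF.atom_subset (hsplit E (hs's hE)).1 hC ⟨x, hxE, hVC ((hVt x).2 ⟨B, hB, hxB⟩)⟩
    have hAW : Disjoint A W := by
      simp only [W, Set.disjoint_iUnion_right]
      intro E hE
      by_contra hd
      obtain ⟨-, B, hB, x, hxE, hxB⟩ := hs' E hE
      have hEA := hF.atom_subset (hsplit E (hs's hE)).1 hA
        (Set.inter_comm A E ▸ Set.not_disjoint_iff_nonempty_inter.1 hd)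
      -- A point of `E` in an atom of `G` outside `t` cannot lie in `V ⊇ A ⊇ E`.
      obtain ⟨B', hB', hxB'⟩ := (hVt x).1 (hAV (hEA hxE))
      exact hB (Subtype.ext (hG.atom_eq B.2 B'.2 ⟨x, hxB, hxB'⟩) ▸ hB')
    have h1 := hF.add A hA W hW hAW
    have h2 := hF.mono (hF.union_mem A hA W hW) hC (Set.union_subset (hAV.trans hVC) hWC)
    have h3 := hF.biUnion_eq s hmem hdisj
    linarith

end IsFinitelyAdditive

end NSA

/-! ### Building transferable sentences -/

namespace NSA

open EType

namespace Formula

variable {S : Type u} {Γ : List EType}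

/-- The biconditional, which is not a primitive of the language. -/
def iff (φ ψ : Formula S Γ) : Formula S Γ := and (imp φ ψ) (imp ψ φ)

/-- The formula `x ∈ A` for variables `x` and `A`. -/
def memVar {τ : EType} (x : Var Γ τ) (A : Var Γ (pow τ)) : Formula S Γ := mem (.var x) (.var A)

/-- The formula `(x, y) ∈ R`, for a constant `R`: it makes a standard binary relation available as a
predicate of the language. -/
def holdsPair {σ τ : EType} (x : Var Γ σ) (y : Var Γ τ) (R : Std S (pow (prod σ τ))) : Formula S Γ :=
  mem (.pair (.var x) (.var y)) (.const R)

/-- The formula `((x, y), z) ∈ R`, for a constant `R`. -/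
def holdsTriple {ρ σ τ : EType} (x : Var Γ ρ) (y : Var Γ σ) (z : Var Γ τ)
    (R : Std S (pow (prod (prod ρ σ) τ))) : Formula S Γ :=
  mem (.pair (.pair (.var x) (.var y)) (.var z)) (.const R)

/-- The formula `(x, y) ∈ f` for variables `x`, `y` and `f`. -/
def graph {σ τ : EType} (x : Var Γ σ) (y : Var Γ τ) (f : Var Γ (pow (prod σ τ))) : Formula S Γ :=
  mem (.pair (.var x) (.var y)) (.var f)

end Formula

/-- The de Bruijn variables: `v0` is bound by the innermost quantifier, `v1` by the next one, and
so on. -/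
def v0 {Γ : List EType} {a : EType} : Var (a :: Γ) a := .zero
def v1 {Γ : List EType} {a b : EType} : Var (a :: b :: Γ) b := .succ v0
def v2 {Γ : List EType} {a b c : EType} : Var (a :: b :: c :: Γ) c := .succ v1
def v3 {Γ : List EType} {a b c d : EType} : Var (a :: b :: c :: d :: Γ) d := .succ v2
def v4 {Γ : List EType} {a b c d e : EType} : Var (a :: b :: c :: d :: e :: Γ) e := .succ v3
def v5 {Γ : List EType} {a b c d e f : EType} : Var (a :: b :: c :: d :: e :: f :: Γ) f := .succ v4
def v6 {Γ : List EType} {a b c d e f g : EType} : Var (a :: b :: c :: d :: e :: f :: g :: Γ) g :=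
  .succ v5
def v7 {Γ : List EType} {a b c d e f g h : EType} :
    Var (a :: b :: c :: d :: e :: f :: g :: h :: Γ) h := .succ v6
def v8 {Γ : List EType} {a b c d e f g h i : EType} :
    Var (a :: b :: c :: d :: e :: f :: g :: h :: i :: Γ) i := .succ v7

namespace Std

variable (S : Type u)

/-- The graph of real addition, as in the definition of `NonstandardUniverse.add`. -/
def sumGraph : Std S (pow (prod (prod real real) real)) :=
  {p | p.fst.fst.toReal + p.fst.snd.toReal = p.snd.toReal}

/-- The order of the reals, as in the definition of `NonstandardUniverse.le`. -/
def leGraph : Std S (pow (prod real real)) := {p | p.fst.toReal ≤ p.snd.toReal}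

/-- The relation `a + u / 2 ≤ c` between reals, encoded by the triples `((u, a), c)`. -/
def halfGap : Std S (pow (prod (prod real real) real)) :=
  {p | p.fst.snd.toReal + p.fst.fst.toReal / 2 ≤ p.snd.toReal}

/-- The collection of finite sets of entities of type `τ`. -/
def finiteSets (τ : EType) : Std S (pow (pow τ)) := {X : Set (Std S τ) | X.Finite}

/-- The triples `((Ω, F), μ)` where `F` is a finite algebra of subsets of `Ω` and `μ` is the graph
of a finitely additive measure on `F`. -/
def measureSpaces (τ : EType) :
    Std S (pow (prod (prod (pow τ) (pow (pow τ))) (pow (prod (pow τ) real)))) :=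
  {p | Set.Finite (α := Set (Std S τ)) p.fst.snd ∧ ∃ m : Set (Std S τ) → ℝ,
    IsFinitelyAdditive (T := Std S τ) p.fst.fst p.fst.snd m ∧
    ∀ (A : Std S (pow τ)) (x : Std S real), Std.Mem (τ := prod (pow τ) real) (A, x) p.snd ↔
      Std.Mem A p.fst.snd ∧ x.toReal = m A}

/-- The pairs `(F, A)` with `A` an atom of `F`. -/
def atoms (τ : EType) : Std S (pow (prod (pow (pow τ)) (pow τ))) :=
  {p | IsAtomOf (T := Std S τ) p.fst p.snd}

/-- The triples `((F, G), A)` with `A` an atom of `F` meeting two atoms of `G`. -/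
def splitAtoms (τ : EType) : Std S (pow (prod (prod (pow (pow τ)) (pow (pow τ))) (pow τ))) :=
  {p | IsSplitAtomOf (T := Std S τ) p.fst.fst p.fst.snd p.snd}

end Std

/-! ### Instances of transfer -/

namespace NonstandardUniverse

open Formula

variable {S : Type u} (N : NonstandardUniverse.{u, v} S) {τ : EType}

theorem mem_star_splitAtoms (F G : N.El (pow (pow τ))) (A : N.El (pow τ)) :
    N.mem (N.pair (N.pair F G) A) (N.star (Std.splitAtoms S τ)) ↔
      N.mem (N.pair F A) (N.star (Std.atoms S τ)) ∧ ∃ B B',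
        N.mem (N.pair G B) (N.star (Std.atoms S τ)) ∧
        N.mem (N.pair G B') (N.star (Std.atoms S τ)) ∧ ¬ B = B' ∧
        (∃ x, N.mem x A ∧ N.mem x B) ∧ ∃ x, N.mem x A ∧ N.mem x B' :=
  have h := (N.transfer
    (all (pow (pow τ)) <| all (pow (pow τ)) <| all (pow τ) <|
      iff (holdsTriple v2 v1 v0 (Std.splitAtoms S τ)) <|
        and (holdsPair v2 v0 (Std.atoms S τ)) <| ex (pow τ) <| ex (pow τ) <|
        and (holdsPair v3 v1 (Std.atoms S τ)) <| and (holdsPair v3 v0 (Std.atoms S τ)) <|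
        and (neg (eq (.var v1) (.var v0))) <|
        and (ex τ (and (memVar v0 v3) (memVar v0 v2)))
          (ex τ (and (memVar v0 v3) (memVar v0 v1))))).1
    fun _ _ _ => ⟨id, id⟩
  ⟨(h F G A).1, (h F G A).2⟩

theorem mem_star_atoms (F : N.El (pow (pow τ))) (A : N.El (pow τ)) :
    N.mem (N.pair F A) (N.star (Std.atoms S τ)) ↔
      N.mem A F ∧ (∃ x, N.mem x A) ∧
        ∀ E, N.mem E F → (∃ x, N.mem x E) → (∀ x, N.mem x E → N.mem x A) → E = A :=
  have h := (N.transfer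
    (all (pow (pow τ)) <| all (pow τ) <|
      iff (holdsPair v1 v0 (Std.atoms S τ)) <|
        and (memVar v0 v1) <| and (ex τ (memVar v0 v1)) <|
        all (pow τ) <| imp (memVar v0 v2) <| imp (ex τ (memVar v0 v1)) <|
          imp (all τ (imp (memVar v0 v1) (memVar v0 v2))) (eq (.var v0) (.var v1)))).1
    fun _ _ => ⟨id, id⟩
  ⟨(h F A).1, (h F A).2⟩

theorem pair_add_mem_star_sumGraph (x y : N.El EType.real) :
    N.mem (N.pair (N.pair x y) (N.add x y)) (N.star (Std.sumGraph S)) :=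
  have h := (N.transfer
    (all EType.real <| all EType.real <| ex EType.real (holdsTriple v2 v1 v0 (Std.sumGraph S)))).1
    fun x y => ⟨Std.ofReal (S := S) (Std.toReal (S := S) x + Std.toReal (S := S) y),
      Eq.refl (Std.toReal (S := S) x + Std.toReal (S := S) y)⟩
  Classical.epsilon_spec (h x y)

theorem real_le_trans {r : ℝ} {x y : N.El EType.real} (hx : N.le (N.real r) x) (hxy : N.le x y) :
    N.le (N.real r) y :=
  have h := (N.transfer
    (all EType.real <| all EType.real <| imp (mem (.pair (.const (Std.ofReal r)) (.var v1))
      (.const (Std.leGraph S))) <|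
      imp (holdsPair v1 v0 (Std.leGraph S))
      (mem (.pair (.const (Std.ofReal r)) (.var v0)) (.const (Std.leGraph S))))).1
    fun _ _ (hx : r ≤ _) (hxy : _ ≤ _) => (hx.trans hxy : r ≤ _)
  h x y hx hxy

theorem real_le_real {r s : ℝ} : N.le (N.real r) (N.real s) ↔ r ≤ s :=
  (N.transfer (mem (.pair (.const (Std.ofReal r)) (.const (Std.ofReal s)))
    (.const (Std.leGraph S)))).symm

theorem le_total (x y : N.El EType.real) : N.le x y ∨ N.le y x :=
  have h := (N.transfer
    (all EType.real <| all EType.real <| or (holdsPair v1 v0 (Std.leGraph S))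
      (holdsPair v0 v1 (Std.leGraph S)))).1
    fun x y => _root_.le_total (Std.toReal x) (Std.toReal y)
  h x y

theorem real_le_of_halfGap {ε r : ℝ} {u a c : N.El EType.real}
    (h : N.mem (N.pair (N.pair u a) c) (N.star (Std.halfGap S)))
    (hu : N.le (N.real ε) u) (ha : N.le (N.real r) a) : N.le (N.real (r + ε / 2)) c :=
  have h' := (N.transfer
    (all EType.real <| all EType.real <| all EType.real <| imp (holdsTriple v2 v1 v0 (Std.halfGap S)) <|
      imp (mem (.pair (.const (Std.ofReal ε)) (.var v2)) (.const (Std.leGraph S))) <|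
      imp (mem (.pair (.const (Std.ofReal r)) (.var v1)) (.const (Std.leGraph S)))
      (mem (.pair (.const (Std.ofReal (r + ε / 2))) (.var v0)) (.const (Std.leGraph S))))).1
    (by
      intro u a c h hu ha
      change Std.toReal (S := S) a + Std.toReal (S := S) u / 2 ≤ Std.toReal (S := S) c at h
      change ε ≤ Std.toReal (S := S) u at hu
      change r ≤ Std.toReal (S := S) a at ha
      change r + ε / 2 ≤ Std.toReal (S := S) c
      linarith)
  h' u a c h hu ha

/-- The axioms of a hyperfinite internal measure algebra, in first-order form, put it in the
nonstandard extension of `Std.measureSpaces`. Biconditionals appear as conjunctions so that each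
hypothesis is definitionally the satisfaction of the corresponding formula. -/
theorem mem_star_measureSpaces {Ω : N.El (pow τ)} {F : N.El (pow (pow τ))}
    {μ : N.El (pow (prod (pow τ) EType.real))} (hfin : N.mem F (N.star (Std.finiteSets S (pow τ))))
    (hsub : ∀ A, N.mem A F → ∀ x, N.mem x A → N.mem x Ω) (huniv : N.mem Ω F)
    (hcompl : ∀ A, N.mem A F → ∃ C, N.mem C F ∧
      ∀ x, (N.mem x C → N.mem x Ω ∧ ¬ N.mem x A) ∧ (N.mem x Ω ∧ ¬ N.mem x A → N.mem x C))
    (hunion : ∀ A B, N.mem A F → N.mem B F → ∃ C, N.mem C F ∧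
      ∀ x, (N.mem x C → N.mem x A ∨ N.mem x B) ∧ (N.mem x A ∨ N.mem x B → N.mem x C))
    (hdom : ∀ A x, N.mem (N.pair A x) μ → N.mem A F)
    (hex : ∀ A, N.mem A F → ∃ x, N.mem (N.pair A x) μ)
    (hfun : ∀ A x y, N.mem (N.pair A x) μ → N.mem (N.pair A y) μ → x = y)
    (hnonneg : ∀ A x, N.mem (N.pair A x) μ → N.le (N.real 0) x)
    (hadd : ∀ A B C, N.mem A F → N.mem B F → N.mem C F →
      (∀ x, N.mem x A → ¬ N.mem x B) →
      (∀ x, (N.mem x C → N.mem x A ∨ N.mem x B) ∧ (N.mem x A ∨ N.mem x B → N.mem x C)) →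
      ∀ a b c, N.mem (N.pair A a) μ → N.mem (N.pair B b) μ → N.mem (N.pair C c) μ →
        N.mem (N.pair (N.pair a b) c) (N.star (Std.sumGraph S))) :
    N.mem (N.pair (N.pair Ω F) μ) (N.star (Std.measureSpaces S τ)) :=
  have h := (N.transfer
    (all (pow τ) <| all (pow (pow τ)) <| all (pow (prod (pow τ) EType.real)) <|
      imp (mem (.var v1) (.const (Std.finiteSets S (pow τ)))) <|
      imp (all (pow τ) <| imp (memVar v0 v2) <| all τ <| imp (memVar v0 v1) (memVar v0 v4)) <|
      imp (memVar v2 v1) <|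
      imp (all (pow τ) <| imp (memVar v0 v2) <| ex (pow τ) <| and (memVar v0 v3) <|
        all τ <| iff (memVar v0 v1) <| and (memVar v0 v5) (neg (memVar v0 v2))) <|
      imp (all (pow τ) <| all (pow τ) <| imp (memVar v1 v3) <| imp (memVar v0 v3) <|
        ex (pow τ) <| and (memVar v0 v4) <|
        all τ <| iff (memVar v0 v1) <| or (memVar v0 v3) (memVar v0 v2)) <|
      imp (all (pow τ) <| all EType.real <| imp (graph v1 v0 v2) <| memVar v1 v3) <|
      imp (all (pow τ) <| imp (memVar v0 v2) <| ex EType.real <| graph v1 v0 v2) <|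
      imp (all (pow τ) <| all EType.real <| all EType.real <| imp (graph v2 v1 v3) <| imp (graph v2 v0 v3) <|
        eq (.var v1) (.var v0)) <|
      imp (all (pow τ) <| all EType.real <| imp (graph v1 v0 v2) <|
        mem (.pair (.const (Std.ofReal 0)) (.var v0)) (.const (Std.leGraph S))) <|
      imp (all (pow τ) <| all (pow τ) <| all (pow τ) <| imp (memVar v2 v4) <| imp (memVar v1 v4) <|
        imp (memVar v0 v4) <| imp (all τ <| imp (memVar v0 v3) <| neg (memVar v0 v2)) <|
        imp (all τ <| iff (memVar v0 v1) <| or (memVar v0 v3) (memVar v0 v2)) <|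
        all EType.real <| all EType.real <| all EType.real <| imp (graph v5 v2 v6) <|
          imp (graph v4 v1 v6) <| imp (graph v3 v0 v6) <| holdsTriple v2 v1 v0 (Std.sumGraph S)) <|
      holdsTriple v2 v1 v0 (Std.measureSpaces S τ))).1
    (by
      intro Ω F μ hfin hsub huniv hcompl hunion hdom hex hfun hnonneg hadd
      have : Nonempty ((standard S).El EType.real) := ⟨Std.ofReal (S := S) 0⟩
      choose! m hm using hex
      let m' : Set (Std S τ) → ℝ := fun A => Std.toReal (S := S) (m A)
      refine ⟨hfin, m', ⟨hsub, huniv, ?_, ?_, ?_, ?_⟩, ?_⟩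
      · intro A hA
        obtain ⟨C, hC, h⟩ := hcompl A hA
        have : C = ((Ω : Set (Std S τ)) \ A : Set (Std S τ)) :=
          Set.ext fun x => ⟨(h x).1, (h x).2⟩
        exact this ▸ hC
      · intro A hA B hB
        obtain ⟨C, hC, h⟩ := hunion A B hA hB
        have : C = (A ∪ B : Set (Std S τ)) :=
          Set.ext fun x => ⟨(h x).1, (h x).2⟩
        exact this ▸ hC
      · exact fun A hA => hnonneg A (m A) (hm A hA)
      · intro A hA B hB hd
        obtain ⟨C, hC, h⟩ := hunion A B hA hB
        have e : C = (A ∪ B : Set (Std S τ)) :=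
          Set.ext fun x => ⟨(h x).1, (h x).2⟩
        have := hadd A B C hA hB hC (fun x hx hx' => Set.disjoint_left.1 hd hx hx') h
          (m A) (m B) (m C) (hm A hA) (hm B hB) (hm C hC)
        rw [← e]
        exact Eq.symm this
      · intro A x
        refine ⟨fun h => ⟨hdom A x h,
          congrArg (Std.toReal (S := S)) (hfun A x _ h (hm A (hdom A x h)))⟩, ?_⟩
        rintro ⟨hA, hx⟩
        have : x = m A := ULift.ext _ _ hx
        exact this ▸ hm A hA)
  h Ω F μ hfin hsub huniv hcompl hunion hdom hex hfun hnonneg hadd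

theorem le_of_subset {Ω : N.El (pow τ)} {F : N.El (pow (pow τ))}
    {μ : N.El (pow (prod (pow τ) EType.real))}
    (h : N.mem (N.pair (N.pair Ω F) μ) (N.star (Std.measureSpaces S τ))) {A B : N.El (pow τ)}
    (hAB : ∀ x, N.mem x A → N.mem x B) {a b : N.El EType.real}
    (ha : N.mem (N.pair A a) μ) (hb : N.mem (N.pair B b) μ) : N.le a b :=
  have h' := (N.transfer
    (all (pow τ) <| all (pow (pow τ)) <| all (pow (prod (pow τ) EType.real)) <|
      imp (holdsTriple v2 v1 v0 (Std.measureSpaces S τ)) <|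
      all (pow τ) <| all (pow τ) <| imp (all τ <| imp (memVar v0 v2) (memVar v0 v1)) <|
      all EType.real <| all EType.real <| imp (graph v3 v1 v4) <| imp (graph v2 v0 v4) <|
      holdsPair v1 v0 (Std.leGraph S))).1
    (by
      rintro Ω F μ ⟨-, m, hm, hμ⟩ A B hAB a b ha hb
      obtain ⟨hA, ha⟩ := (hμ A a).1 ha
      obtain ⟨hB, hb⟩ := (hμ B b).1 hb
      change Std.toReal (S := S) a ≤ Std.toReal (S := S) b
      rw [ha, hb]
      exact hm.mono hA hB hAB)
  h' Ω F μ h A B hAB a b ha hb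

/-- Transfer of `IsFinitelyAdditive.exists_defect`. Here `U` is internal because it is
produced by transfer. -/
theorem exists_defect {Ω : N.El (pow τ)} {F G : N.El (pow (pow τ))}
    {μ ν : N.El (pow (prod (pow τ) EType.real))}
    (hF : N.mem (N.pair (N.pair Ω F) μ) (N.star (Std.measureSpaces S τ)))
    (hG : N.mem (N.pair (N.pair Ω G) ν) (N.star (Std.measureSpaces S τ))) :
    ∃ U V, N.mem U F ∧
      (∀ x, (N.mem x U → ∃ A, N.mem (N.pair (N.pair F G) A) (N.star (Std.splitAtoms S τ)) ∧
        N.mem x A) ∧ ((∃ A, N.mem (N.pair (N.pair F G) A) (N.star (Std.splitAtoms S τ)) ∧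
        N.mem x A) → N.mem x U)) ∧ N.mem V G ∧
      ∀ A C, (∀ x, N.mem x A → N.mem x V) → (∀ x, N.mem x V → N.mem x C) →
        ∀ u a c, N.mem (N.pair U u) μ → N.mem (N.pair A a) μ → N.mem (N.pair C c) μ →
          N.mem (N.pair (N.pair u a) c) (N.star (Std.halfGap S)) :=
  have h := (N.transfer
    (all (pow τ) <| all (pow (pow τ)) <| all (pow (pow τ)) <| all (pow (prod (pow τ) EType.real)) <|
      all (pow (prod (pow τ) EType.real)) <|
      imp (holdsTriple v4 v3 v1 (Std.measureSpaces S τ)) <|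
      imp (holdsTriple v4 v2 v0 (Std.measureSpaces S τ)) <|
      ex (pow τ) <| ex (pow τ) <| and (memVar v1 v5) <|
      and (all τ <| iff (memVar v0 v2) <| ex (pow τ) <|
        and (holdsTriple v7 v6 v0 (Std.splitAtoms S τ)) (memVar v1 v0)) <|
      and (memVar v0 v4) <|
      all (pow τ) <| all (pow τ) <| imp (all τ <| imp (memVar v0 v2) (memVar v0 v3)) <|
      imp (all τ <| imp (memVar v0 v3) (memVar v0 v1)) <|
      all EType.real <| all EType.real <| all EType.real <| imp (graph v6 v2 v8) <|
        imp (graph v4 v1 v8) <|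
        imp (graph v3 v0 v8) <| holdsTriple v2 v1 v0 (Std.halfGap S))).1
    (by
      rintro Ω F G μ ν ⟨hfF, m, hm, hμ⟩ ⟨hfG, n, hn, -⟩
      obtain ⟨U, V, hU, hUx, hV, hAC⟩ := hm.exists_defect hn hfF hfG
      refine ⟨U, V, hU, fun x => ⟨(hUx x).1, (hUx x).2⟩, hV, ?_⟩
      intro A C hAV hVC u a c hu ha hc
      obtain ⟨-, hu⟩ := (hμ U u).1 hu
      obtain ⟨hA, ha⟩ := (hμ A a).1 ha
      obtain ⟨hC, hc⟩ := (hμ C c).1 hc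
      change Std.toReal (S := S) a + Std.toReal (S := S) u / 2 ≤ Std.toReal (S := S) c
      rw [hu, ha, hc]
      exact hAC A hA C hC hAV hVC)
  h Ω F G μ ν hF hG

end NonstandardUniverse

end NSA

/-! ### Standard parts and Loeb measurability -/

namespace NSA

open EType

namespace NonstandardUniverse

variable {S : Type u} (N : NonstandardUniverse.{u, v} S)

theorem bddAbove_real_le {x : N.El EType.real} {b : ℝ} (hx : N.le x (N.real b)) :
    BddAbove {r : ℝ | N.le (N.real r) x} :=
  ⟨b, fun _ hr => N.real_le_real.1 (N.real_le_trans hr hx)⟩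

theorem st_mono {x y : N.El EType.real} {a b : ℝ} (hx : N.le (N.real a) x) (hxy : N.le x y)
    (hy : N.le y (N.real b)) : N.st x ≤ N.st y :=
  csSup_le_csSup (N.bddAbove_real_le hy) ⟨a, hx⟩ fun _ hr => N.real_le_trans hr hxy

theorem st_add_le_of_halfGap {ε a₀ b : ℝ} {u a c : N.El EType.real}
    (h : N.mem (N.pair (N.pair u a) c) (N.star (Std.halfGap S)))
    (hu : N.le (N.real ε) u) (ha : N.le (N.real a₀) a) (hc : N.le c (N.real b)) :
    N.st a + ε / 2 ≤ N.st c := by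
  rw [← le_sub_iff_add_le]
  refine csSup_le ⟨a₀, ha⟩ fun r hr => ?_
  rw [le_sub_iff_add_le]
  exact le_csSup (N.bddAbove_real_le hc) (N.real_le_of_halfGap h hu hr)

end NonstandardUniverse

namespace InternalProbSpace

variable {S : Type u} {N : NonstandardUniverse.{u, v} S} {τ : EType} {Ω : N.El (pow τ)}
  (P Q : InternalProbSpace N Ω)

theorem mem_meas {A : N.El (pow τ)} (hA : N.mem A P.alg) :
    N.mem (N.pair A (N.app P.meas A)) P.meas :=
  Classical.epsilon_spec (P.meas_fun A hA).exists

variable {P Q}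

theorem app_eq {A : N.El (pow τ)} {x : N.El EType.real} (h : N.mem (N.pair A x) P.meas) :
    N.app P.meas A = x :=
  (P.meas_fun A (P.meas_dom A x h)).unique (P.mem_meas (P.meas_dom A x h)) h

theorem IsHyperfinite.mem_star_measureSpaces (hP : P.IsHyperfinite) :
    N.mem (N.pair (N.pair Ω P.alg) P.meas) (N.star (Std.measureSpaces S τ)) := by
  refine N.mem_star_measureSpaces hP (fun A hA x hx => P.subset_of_mem A hA hx) P.univ_mem
    ?_ ?_ P.meas_dom (fun A hA => (P.meas_fun A hA).exists) ?_ ?_ ?_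
  · intro A hA
    obtain ⟨C, hC, h⟩ := P.compl_mem A hA
    exact ⟨C, hC, fun x => ⟨(Set.ext_iff.1 h x).1, (Set.ext_iff.1 h x).2⟩⟩
  · intro A B hA hB
    obtain ⟨C, hC, h⟩ := P.union_mem A B hA hB
    exact ⟨C, hC, fun x => ⟨(Set.ext_iff.1 h x).1, (Set.ext_iff.1 h x).2⟩⟩
  · exact fun A x y hx hy => (P.meas_fun A (P.meas_dom A x hx)).unique hx hy
  · intro A x hx
    rw [← app_eq hx]
    exact P.meas_nonneg A (P.meas_dom A x hx)
  · intro A B C hA hB hC hd hu a b c ha hb hc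
    have := P.meas_union A B C hA hB hC (Set.disjoint_left.2 fun x => hd x)
      (Set.ext fun x => ⟨(hu x).1, (hu x).2⟩)
    rw [app_eq ha, app_eq hb, app_eq hc] at this
    rw [this]
    exact N.pair_add_mem_star_sumGraph a b

theorem IsHyperfinite.le_of_subset (hP : P.IsHyperfinite) {A B : N.El (pow τ)}
    (hA : N.mem A P.alg) (hB : N.mem B P.alg) (hAB : N.ext A ⊆ N.ext B) :
    N.le (N.app P.meas A) (N.app P.meas B) :=
  N.le_of_subset hP.mem_star_measureSpaces (fun _ hx => hAB hx) (P.mem_meas hA) (P.mem_meas hB)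

theorem IsHyperfinite.le_one (hP : P.IsHyperfinite) {A : N.El (pow τ)} (hA : N.mem A P.alg) :
    N.le (N.app P.meas A) (N.real 1) :=
  P.meas_univ ▸ hP.le_of_subset hA P.univ_mem (P.subset_of_mem A hA)

theorem IsHyperfinite.st_mono (hP : P.IsHyperfinite) {A B : N.El (pow τ)}
    (hA : N.mem A P.alg) (hB : N.mem B P.alg) (hAB : N.ext A ⊆ N.ext B) :
    N.st (N.app P.meas A) ≤ N.st (N.app P.meas B) :=
  N.st_mono (P.meas_nonneg A hA) (hP.le_of_subset hA hB hAB) (hP.le_one hB)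

/-- A member `V` of the internal algebra is Loeb measurable: `st (μ V)` is both the largest inner and
the smallest outer approximation. -/
theorem IsHyperfinite.ext_mem_loebAlgebra (hP : P.IsHyperfinite) {V : N.El (pow τ)}
    (hV : N.mem V P.alg) : N.ext V ∈ P.loebAlgebra := by
  refine ⟨P.subset_of_mem V hV, ?_⟩
  have h1 : P.inner (N.ext V) = N.st (N.app P.meas V) :=
    IsGreatest.csSup_eq ⟨⟨V, hV, subset_rfl, rfl⟩, by
      rintro _ ⟨A, hA, hAV, rfl⟩
      exact hP.st_mono hA hV hAV⟩
  have h2 : P.outer (N.ext V) = N.st (N.app P.meas V) :=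
    IsLeast.csInf_eq ⟨⟨V, hV, subset_rfl, rfl⟩, by
      rintro _ ⟨C, hC, hVC, rfl⟩
      exact hP.st_mono hV hC hVC⟩
  rw [h1, h2]

theorem exists_subset_mem (P : InternalProbSpace N Ω) (B : Set (N.El τ)) :
    ∃ A, N.mem A P.alg ∧ N.ext A ⊆ B := by
  obtain ⟨C, hC, h⟩ := P.compl_mem Ω P.univ_mem
  exact ⟨C, hC, by simp [h]⟩

/-- A uniform gap between inner and outer approximations of `B` separates the inner from the outer
measure. The suprema and infima are over nonempty sets: `∅` lies inside `B` and `Ω` outside. -/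
theorem add_le_outer {B : Set (N.El τ)} (hB : B ⊆ N.ext Ω) {δ : ℝ}
    (h : ∀ A C, N.mem A P.alg → N.mem C P.alg → N.ext A ⊆ B → B ⊆ N.ext C →
      N.st (N.app P.meas A) + δ ≤ N.st (N.app P.meas C)) :
    P.inner B + δ ≤ P.outer B := by
  refine le_csInf ⟨_, Ω, P.univ_mem, hB, rfl⟩ ?_
  rintro _ ⟨C, hC, hBC, rfl⟩
  rw [← le_sub_iff_add_le]
  obtain ⟨A₀, hA₀, hA₀B⟩ := P.exists_subset_mem B
  refine csSup_le ⟨_, A₀, hA₀, hA₀B, rfl⟩ ?_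
  rintro _ ⟨A, hA, hAB, rfl⟩
  exact le_sub_iff_add_le.2 (h A C hA hC hAB hBC)

theorem isAtom_iff (A : N.El (pow τ)) :
    P.IsAtom A ↔ N.mem (N.pair P.alg A) (N.star (Std.atoms S τ)) :=
  (N.mem_star_atoms P.alg A).symm

theorem mem_splitAtoms_iff (A : N.El (pow τ)) :
    A ∈ P.splitAtoms Q ↔
      N.mem (N.pair (N.pair P.alg Q.alg) A) (N.star (Std.splitAtoms S τ)) := by
  rw [N.mem_star_splitAtoms]
  simp only [← isAtom_iff]
  rfl

end InternalProbSpace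

end NSA

/-! ### Split atoms of Loeb equivalent spaces -/

theorem theorem2p3 {S : Type u} (N : NSA.NonstandardUniverse.{u, v} S) {τ : NSA.EType}
    (Ω : N.El (NSA.EType.pow τ)) (P Q : NSA.InternalProbSpace N Ω)
    (hP : P.IsHyperfinite) (hQ : Q.IsHyperfinite) (hPQ : P.LoebEquivalent Q) :
    ∃ U : N.El (NSA.EType.pow τ), N.mem U P.alg ∧
      N.ext U = (⋃ A ∈ P.splitAtoms Q, N.ext A) ∧
      N.Infinitesimal (N.app P.meas U) := by
  obtain ⟨U, V, hU, hUx, hV, hgap⟩ :=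
    N.exists_defect hP.mem_star_measureSpaces hQ.mem_star_measureSpaces
  refine ⟨U, hU, ?_, fun ε hε => ⟨?_, ?_⟩⟩
  · ext x
    simp only [Set.mem_iUnion, exists_prop, NSA.InternalProbSpace.mem_splitAtoms_iff]
    exact ⟨(hUx x).1, (hUx x).2⟩
  · exact N.real_le_trans (N.real_le_real.2 (by linarith)) (P.meas_nonneg U hU)
  · by_contra hlt
    -- Otherwise `V` would have a Loeb defect of at least `ε / 2` with respect to `P`.
    have hε_le : N.le (N.real ε) (N.app P.meas U) := (N.le_total _ _).resolve_right hlt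
    have hVP : N.ext V ∈ P.loebAlgebra := hPQ.1 ▸ hQ.ext_mem_loebAlgebra hV
    have hdefect : P.inner (N.ext V) + ε / 2 ≤ P.outer (N.ext V) :=
      NSA.InternalProbSpace.add_le_outer hVP.1 fun A C hA hC hAV hVC =>
        N.st_add_le_of_halfGap
          (hgap A C (fun _ hx => hAV hx) (fun _ hx => hVC hx) _ _ _ (P.mem_meas hU)
            (P.mem_meas hA) (P.mem_meas hC))
          hε_le (P.meas_nonneg A hA) (hP.le_one hC)
    linarith [hVP.2]
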